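/- Let $G$ be a precompact Hausdorff abelian topological group (that is, its Raĭkov completion is compact) of square-free exponent, i.e. the least positive integer $n$ with $nx=0$ for all $x\in G$ exists and is square-free. Then the following are equivalent: (a) $G$ is compact; (b) $G$ is minimal, i.e. every Hausdorff group topology on $G$ that is coarser than or equal to the given topology $\tau$ equals $\tau$; (c) $G$ is locally minimal, i.e. there is a $\tau$-neighborhood $V$ of $0$ such that every Hausdorff group topology $\sigma\subseteq\tau$ on $G$ for which $V$ is a $\sigma$-neighborhood of $0$ equals $\tau$. -/

import Mathlib

/-- An abelian topological group is precompact if its completion (with respect to the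
group uniformity; for an abelian group the left, right and two-sided uniformities agree,
so this is the Raikov completion) is compact. -/
def IsPrecompactAddGroup (G : Type*) [AddCommGroup G] [TopologicalSpace G]
    [IsTopologicalAddGroup G] : Prop :=
  letI : UniformSpace G := IsTopologicalAddGroup.rightUniformSpace G
  CompactSpace (UniformSpace.Completion G)

/-- A Hausdorff topological group `(G, τ)` is minimal if every Hausdorff group topology `σ`
on `G` coarser than `τ` equals `τ`. In Mathlib's order on topologies, `τ ≤ σ` means that `σ` is
coarser than `τ`. -/
def IsMinimalAddGroup (G : Type*) [AddCommGroup G] [τ : TopologicalSpace G]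
    [IsTopologicalAddGroup G] : Prop :=
  T2Space G ∧ ∀ σ : TopologicalSpace G,
    @IsTopologicalAddGroup G σ _ → @T2Space G σ → τ ≤ σ → σ = τ

/-- A Hausdorff topological group `(G, τ)` is locally minimal if there is a `τ`-neighborhood `V`
of `0` such that every Hausdorff group topology `σ` on `G`, coarser than `τ` and for which `V` is
still a neighborhood of `0`, equals `τ`. -/
def IsLocallyMinimalAddGroup (G : Type*) [AddCommGroup G] [τ : TopologicalSpace G]
    [IsTopologicalAddGroup G] : Prop :=
  T2Space G ∧ ∃ V ∈ @nhds G τ 0, ∀ σ : TopologicalSpace G,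
    @IsTopologicalAddGroup G σ _ → @T2Space G σ → τ ≤ σ → V ∈ @nhds G σ 0 → σ = τ

open Filter Topology

/-! Only local minimality ⇒ compactness needs work. Let `K` be the completion of `G`. If a closed
subgroup `N` of `K` meets `G` trivially, `K ⧸ N` induces a coarser Hausdorff topology on `G`; when
`N` is small, local minimality makes it the original one, forcing `N = ⊥`. If `x ∈ K` lay outside
`G`, squarefreeness would give `p * m = n`, `p` prime, with `m • x ∉ G`. For `g ∈ G` near `x`, `y =
m • (x - g)` is small, outside `G` and killed by `p`, so it spans a small group of prime order
meeting `G` trivially: a contradiction. Hence `G = K`. -/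

/-- In a compact Hausdorff group, every coarser Hausdorff group topology is the given one. -/
theorem isMinimalAddGroup_of_compactSpace (G : Type*) [AddCommGroup G] [τ : TopologicalSpace G]
    [IsTopologicalAddGroup G] [T2Space G] [CompactSpace G] : IsMinimalAddGroup G := by
  refine ⟨inferInstance, fun σ _ hT2 hle => le_antisymm ?_ hle⟩
  have hcont : @Continuous G G τ σ id := continuous_id_of_le hle
  have hclosed := @Continuous.isClosedMap G G τ σ _ hT2 id hcont
  intro U hU
  rw [← @isClosed_compl_iff G σ]
  simpa using hclosed Uᶜ ((@isClosed_compl_iff G τ U).2 hU)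

theorem IsMinimalAddGroup.isLocallyMinimalAddGroup {G : Type*} [AddCommGroup G]
    [TopologicalSpace G] [IsTopologicalAddGroup G] (h : IsMinimalAddGroup G) :
    IsLocallyMinimalAddGroup G :=
  ⟨h.1, Set.univ, univ_mem, fun σ hσ hT2 hle _ => h.2 σ hσ hT2 hle⟩

/-- If every element of `K` is killed by the squarefree number `n`, any element outside a subgroup
`H` has a multiple outside `H` which is killed by a prime divisor of `n`. -/
theorem AddSubgroup.exists_prime_nsmul_notMem {K : Type*} [AddCommGroup K] (H : AddSubgroup K)
    {n : ℕ} (hn : Squarefree n) (hK : ∀ x : K, n • x = 0) {x : K} (hx : x ∉ H) :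
    ∃ p m : ℕ, p.Prime ∧ p * m = n ∧ m • x ∉ H := by
  set d := addOrderOf (x : K ⧸ H)
  have hdn : d ∣ n := by
    rw [addOrderOf_dvd_iff_nsmul_eq_zero, ← QuotientAddGroup.mk_nsmul, hK x,
      QuotientAddGroup.mk_zero]
  have hd1 : d ≠ 1 := by
    rwa [Ne, AddMonoid.addOrderOf_eq_one_iff, QuotientAddGroup.eq_zero_iff]
  obtain ⟨p, hp, hpd⟩ := Nat.exists_prime_and_dvd hd1
  obtain ⟨m, hm⟩ := hpd.trans hdn
  refine ⟨p, m, hp, hm.symm, fun hmem => ?_⟩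
  rw [← QuotientAddGroup.eq_zero_iff, QuotientAddGroup.mk_nsmul,
    ← addOrderOf_dvd_iff_nsmul_eq_zero] at hmem
  have hpp : p * p ∣ n := hm ▸ mul_dvd_mul_left p (hpd.trans hmem)
  exact hp.not_isUnit (hn p hpp)

/-- In a topological group, a neighborhood `W` of `0` contains the cyclic subgroup generated by
any element of order dividing `n` that is close enough to `0`. -/
theorem eventually_zmultiples_subset {K : Type*} [AddCommGroup K] [TopologicalSpace K]
    [IsTopologicalAddGroup K] {n : ℕ} (hn : n ≠ 0) {W : Set K} (hW : W ∈ 𝓝 (0 : K)) :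
    ∀ᶠ y in 𝓝 (0 : K), n • y = 0 → (AddSubgroup.zmultiples y : Set K) ⊆ W := by
  have h : ∀ᶠ y in 𝓝 (0 : K), ∀ k ∈ Finset.range n, k • y ∈ W := by
    rw [eventually_all_finset]
    intro k _
    have : Tendsto (fun y : K => k • y) (𝓝 0) (𝓝 0) := by
      simpa using (continuous_nsmul (M := K) k).tendsto 0
    exact this hW
  classical
  filter_upwards [h] with y hy hny z hz
  obtain ⟨k, hk, rfl⟩ := (IsOfFinAddOrder.mem_zmultiples_iff_mem_range_addOrderOf
    (isOfFinAddOrder_iff_nsmul_eq_zero.2 ⟨n, hn.bot_lt, hny⟩)).1 hz |> Finset.mem_image.1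
  refine hy k (Finset.mem_range.2 ((Finset.mem_range.1 hk).trans_le ?_))
  exact Nat.le_of_dvd hn.bot_lt (addOrderOf_dvd_of_nsmul_eq_zero hny)

/-- A locally minimal dense subgroup is locally essential: it meets every nontrivial closed
subgroup which is contained in a suitable neighborhood of `0`. -/
theorem IsLocallyMinimalAddGroup.exists_nhds_essential {G K : Type*} [AddCommGroup G]
    [τ : TopologicalSpace G] [IsTopologicalAddGroup G] [AddCommGroup K] [TopologicalSpace K]
    [IsTopologicalAddGroup K] [T2Space K] (hG : IsLocallyMinimalAddGroup G) (i : G →+ K)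
    (hi : IsDenseEmbedding i) :
    ∃ W ∈ 𝓝 (0 : K), ∀ N : AddSubgroup K, IsClosed (N : Set K) → (N : Set K) ⊆ W →
      (∀ g, i g ∈ N → g = 0) → N = ⊥ := by
  obtain ⟨-, V, hV, hmin⟩ := hG
  rw [hi.isInducing.nhds_eq_comap, map_zero] at hV
  obtain ⟨U, hU, hUV⟩ := hV
  obtain ⟨W, hW, hWU⟩ := exists_nhds_zero_half hU
  refine ⟨W, hW, fun N hN hNW hNG => ?_⟩
  have : IsClosed (N : Set K) := hN
  let f : G →+ K ⧸ N := (QuotientAddGroup.mk' N).comp i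
  have hfc : Continuous f := QuotientAddGroup.continuous_mk.comp hi.continuous
  have hfi : Function.Injective f := by
    rw [injective_iff_map_eq_zero]
    intro g hg
    exact hNG g ((QuotientAddGroup.eq_zero_iff _).1 hg)
  have hne (y : K) : (comap i (𝓝 y)).NeBot := hi.isDenseInducing.comap_nhds_neBot y
  have hi0 := hi.continuous.tendsto 0
  let σ : TopologicalSpace G := TopologicalSpace.induced f inferInstance
  have hnhds : @nhds G σ 0 = comap f (𝓝 0) := by
    rw [nhds_induced, map_zero]
  have hσ : σ = τ := by
    refine hmin σ (topologicalAddGroup_induced f)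
      (@T2Space.of_injective_continuous _ _ σ _ _ f hfi continuous_induced_dom)
      (continuous_iff_le_induced.1 hfc) ?_
    rw [hnhds]
    -- If `f g` lies in the image of `W`, then `i g ∈ W + N ⊆ W + W ⊆ U`.
    refine ⟨QuotientAddGroup.mk '' W, ?_, ?_⟩
    · simpa using (QuotientAddGroup.isOpenMap_coe (N := N)).image_mem_nhds hW
    · rintro g ⟨w, hw, hwg⟩
      apply hUV
      have hmem : -w + i g ∈ N := QuotientAddGroup.eq.1 hwg
      simpa using hWU w hw _ (hNW hmem)
  rw [eq_bot_iff]
  intro y hy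
  rw [AddSubgroup.mem_bot]
  have := hne y
  -- The trace on `G` of the filter at `y ∈ N` tends to `0` in `K ⧸ N`, hence in `σ = τ`, hence in
  -- `K`; uniqueness of limits gives `y = 0`.
  have h1 : Tendsto i (comap i (𝓝 y)) (𝓝 y) := tendsto_comap
  have h2 : Tendsto f (comap i (𝓝 y)) (𝓝 0) := by
    have h := ((QuotientAddGroup.continuous_mk (N := N)).tendsto y).comp h1
    rwa [(QuotientAddGroup.eq_zero_iff y).2 hy] at h
  have h3 : Tendsto id (comap i (𝓝 y)) (@nhds G τ 0) := by
    rw [← hσ, hnhds]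
    exact tendsto_comap_iff.2 h2
  have h4 : Tendsto i (comap i (𝓝 y)) (𝓝 0) := by
    simpa using hi0.comp h3
  exact tendsto_nhds_unique h1 h4

/-- A locally minimal group of squarefree exponent is not a proper dense subgroup of any
Hausdorff abelian group. -/
theorem IsLocallyMinimalAddGroup.surjective_of_isDenseEmbedding {G K : Type*} [AddCommGroup G]
    [TopologicalSpace G] [IsTopologicalAddGroup G] [AddCommGroup K] [TopologicalSpace K]
    [IsTopologicalAddGroup K] [T2Space K] (hG : IsLocallyMinimalAddGroup G)
    (hexp : Squarefree (AddMonoid.exponent G)) (i : G →+ K) (hi : IsDenseEmbedding i) :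
    Function.Surjective i := by
  set n := AddMonoid.exponent G
  have hK : ∀ x : K, n • x = 0 := by
    refine fun x => hi.dense.induction_on x
      (isClosed_eq (continuous_nsmul n) continuous_const) fun g => ?_
    rw [← map_nsmul, AddMonoid.exponent_nsmul_eq_zero, map_zero]
  obtain ⟨W, hW, hess⟩ := hG.exists_nhds_essential i hi
  by_contra hsurj
  obtain ⟨x, hx⟩ := not_forall.1 hsurj
  obtain ⟨p, m, hp, hpm, hmx⟩ :=
    i.range.exists_prime_nsmul_notMem hexp hK (x := x) (by simpa using hx)
  have htend : Tendsto (fun z : K => m • (x - z)) (𝓝 x) (𝓝 0) := by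
    have h : Continuous fun z : K => m • (x - z) := by fun_prop
    simpa using h.tendsto x
  have hev := htend.eventually (eventually_zmultiples_subset hp.ne_zero hW)
  obtain ⟨_, hz, g, rfl⟩ := mem_closure_iff_nhds.1 (hi.dense x) _ hev
  set y := m • (x - i g) with hy
  have hpy : p • y = 0 := by rw [hy, ← mul_nsmul', hpm, hK]
  have hyG : y ∉ i.range := by
    intro hmem
    apply hmx
    have := i.range.add_mem hmem (i.range.nsmul_mem ⟨g, rfl⟩ m)
    rwa [hy, ← nsmul_add, sub_add_cancel] at this
  have hfin : (AddSubgroup.zmultiples y : Set K).Finite :=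
    finite_zmultiples.2 (isOfFinAddOrder_iff_nsmul_eq_zero.2 ⟨p, hp.pos, hpy⟩)
  have hbot := hess _ hfin.isClosed (hz hpy) fun g' hg' => ?_
  · rw [AddSubgroup.zmultiples_eq_bot] at hbot
    exact hyG (hbot ▸ i.range.zero_mem)
  · obtain ⟨k, hk⟩ := AddSubgroup.mem_zmultiples_iff.1 hg'
    by_cases hpk : (p : ℤ) ∣ k
    · obtain ⟨c, rfl⟩ := hpk
      rw [mul_comm, mul_zsmul, natCast_zsmul, hpy, zsmul_zero] at hk
      exact hi.injective (by rw [← hk, map_zero])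
    -- Here `k` is invertible mod `p`, so `y` is a multiple of `k • y = i g'`.
    · obtain ⟨a, b, hab⟩ := (Nat.prime_iff_prime_int.1 hp).coprime_iff_not_dvd.2 hpk
      refine absurd ?_ hyG
      have : y = b • i g' := by
        rw [← hk, ← mul_zsmul]
        calc y = (a * p + b * k) • y := by rw [hab, one_zsmul]
          _ = (b * k) • y := by
            rw [add_zsmul, mul_zsmul, natCast_zsmul, hpy, zsmul_zero, zero_add]
      rw [this]
      exact i.range.zsmul_mem ⟨g', rfl⟩ b

/-- A precompact locally minimal abelian group of squarefree exponent is compact. -/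
theorem IsLocallyMinimalAddGroup.compactSpace {G : Type*} [AddCommGroup G] [TopologicalSpace G]
    [IsTopologicalAddGroup G] (hG : IsLocallyMinimalAddGroup G) (hpre : IsPrecompactAddGroup G)
    (hexp : Squarefree (AddMonoid.exponent G)) : CompactSpace G := by
  let _ : UniformSpace G := IsTopologicalAddGroup.rightUniformSpace G
  have : IsUniformAddGroup G := isUniformAddGroup_of_addCommGroup
  have : T2Space G := hG.1
  have : CompactSpace (UniformSpace.Completion G) := hpre
  have hi : IsDenseEmbedding (UniformSpace.Completion.toCompl : G →+ UniformSpace.Completion G) :=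
    UniformSpace.Completion.isDenseEmbedding_coe
  have hsurj := hG.surjective_of_isDenseEmbedding hexp _ hi
  refine Topology.IsClosedEmbedding.compactSpace (f := UniformSpace.Completion.toCompl)
    ⟨hi.isEmbedding, ?_⟩
  rw [hsurj.range_eq]
  exact isClosed_univ

theorem corollary4p7 (G : Type*) [AddCommGroup G] [TopologicalSpace G]
    [IsTopologicalAddGroup G] [T2Space G] (hpre : IsPrecompactAddGroup G)
    (hexp : Squarefree (AddMonoid.exponent G)) :
    List.TFAE [CompactSpace G, IsMinimalAddGroup G, IsLocallyMinimalAddGroup G] := by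
  tfae_have 1 → 2 := fun _ => isMinimalAddGroup_of_compactSpace G
  tfae_have 2 → 3 := fun h => h.isLocallyMinimalAddGroup
  tfae_have 3 → 1 := fun h => h.compactSpace hpre hexp
  tfae_finish
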